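/- Let $n\ge 0$, let $\Gamma$ be a (full-rank) lattice in $\mathbb R^n$, and let $M=\mathbb R^n/\Gamma$ be the flat torus with the metric $g$ induced by the Euclidean metric of $\mathbb R^n$. Let $\Delta$ be the Laplace–Beltrami operator of $M$ (with the sign for which $\Delta=\sum_i\partial_i^2$ in the Euclidean coordinates), and let $\kappa(\varphi,\psi)=g(\nabla\varphi,\nabla\psi)$ for smooth $\varphi,\psi:M\to\mathbb C$, where $g$ is extended complex bilinearly to the complexified tangent bundle (so $\kappa(\varphi,\psi)=\sum_i\partial_i\varphi\,\partial_i\psi$). For $\lambda,\mu\in\mathbb C$, a set $\mathcal F$ of smooth functions $M\to\mathbb C$ is a $(\lambda,\mu)$-eigenfamily if $$\Delta\varphi=\lambda\varphi\quad\text{and}\quad\kappa(\varphi,\psi)=\mu\,\varphi\psi\qquad\text{for all }\varphi,\psi\in\mathcal F,$$ and a $(\lambda,\mu)$-eigenfunction is a function that belongs to some $(\lambda,\mu)$-eigenfamily. Let $\Gamma^*=\{k'\in\mathbb R^n\mid\langle k,k'\rangle\in\mathbb Z\ \text{for all }k\in\Gamma\}$ be the dual lattice and, for $\lambda\in\mathbb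 C$, let $$E_\Delta(\lambda)=\Big\{M\to\mathbb C,\ x\mapsto e^{2\pi i\langle k',x\rangle}\ \Big|\ k'\in\Gamma^*,\ \|k'\|^2=-\frac{\lambda}{4\pi^2}\Big\}.$$ Then for every $\lambda\in\mathbb C$: 1. Every element of $E_\Delta(\lambda)$ is a $(\lambda,\lambda)$-eigenfunction on $M$. 2. If $\mu\in\mathbb C$ and $\mathcal F$ is a $(\lambda,\mu)$-eigenfamily on $M$ containing a function that is not identically zero, then there is an $f\in E_\Delta(\lambda)$ with $\operatorname{span}_{\mathbb C}(\mathcal F)=\operatorname{span}_{\mathbb C}\{f\}$; in particular $\lambda=\mu$ and $\operatorname{span}_{\mathbb C}(\mathcal F)$ is one-dimensional. -/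

import Mathlib

noncomputable section

namespace FlatTorusEigen

/-- The torus `ℝⁿ/Γ`. Its smooth structure and its flat metric are the ones for which the projection
`ℝⁿ → ℝⁿ/Γ` is a local diffeomorphism and a local isometry. -/
abbrev FlatTorus {n : ℕ} (Γ : Submodule ℤ (EuclideanSpace ℝ (Fin n))) : Type :=
  EuclideanSpace ℝ (Fin n) ⧸ Γ

variable {n : ℕ} {Γ : Submodule ℤ (EuclideanSpace ℝ (Fin n))}

/-- The projection `ℝⁿ → ℝⁿ/Γ`; its local inverses are isometric charts of the torus. -/
def proj (Γ : Submodule ℤ (EuclideanSpace ℝ (Fin n))) (x : EuclideanSpace ℝ (Fin n)) :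
    FlatTorus Γ :=
  Submodule.Quotient.mk x

/-- The `Γ`-periodic function on `ℝⁿ` given by a function on the torus. -/
def pull (φ : FlatTorus Γ → ℂ) : EuclideanSpace ℝ (Fin n) → ℂ :=
  fun x => φ (proj Γ x)

lemma pull_add (φ : FlatTorus Γ → ℂ) {k : EuclideanSpace ℝ (Fin n)} (hk : k ∈ Γ) :
    (fun x => pull φ (x + k)) = pull φ := by
  funext x
  refine congrArg φ ((Submodule.Quotient.eq Γ).2 ?_)
  simpa using hk

/-- A `Γ`-periodic function descends to the torus. -/
def descend (u : EuclideanSpace ℝ (Fin n) → ℂ) (hu : ∀ k ∈ Γ, ∀ x, u (x + k) = u x) :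
    FlatTorus Γ → ℂ :=
  fun p => Quotient.liftOn p u (fun x y hxy => by
    have h : x - y ∈ Γ := (Submodule.quotientRel_def Γ).1 hxy
    have h2 := hu _ h y
    rwa [add_sub_cancel] at h2)

@[simp] lemma descend_proj (u : EuclideanSpace ℝ (Fin n) → ℂ)
    (hu : ∀ k ∈ Γ, ∀ x, u (x + k) = u x) (x : EuclideanSpace ℝ (Fin n)) :
    descend u hu (proj Γ x) = u x := rfl

/-- Smoothness of a function on the torus. -/
def IsSmooth (φ : FlatTorus Γ → ℂ) : Prop :=
  ContDiff ℝ (⊤ : ℕ∞) (pull φ)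

/-- The Laplace-Beltrami operator of the flat metric: in the isometric charts `g_ij = δ_ij`, so that
it is `∑ᵢ ∂ᵢ²`. -/
def laplaceBeltrami (φ : FlatTorus Γ → ℂ) : FlatTorus Γ → ℂ :=
  descend (Laplacian.laplacian (pull φ)) (fun k hk x => by
    conv_rhs => rw [← pull_add φ hk]
    simp only [InnerProductSpace.laplacian_eq_iteratedFDeriv_stdOrthonormalBasis]
    simp only [iteratedFDeriv_comp_add_right])

/-- The gradient of a complex-valued function, with values in the complexified tangent space `ℂⁿ`. -/
def complexGradient (u : EuclideanSpace ℝ (Fin n) → ℂ) (x : EuclideanSpace ℝ (Fin n)) : Fin n → ℂ :=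
  fun i => fderiv ℝ u x (EuclideanSpace.single i 1)

/-- The conformality operator `κ(φ, ψ) = g(∇φ, ∇ψ)`, where `g` is extended complex bilinearly: in the
isometric charts it is `∑ᵢ ∂ᵢφ ∂ᵢψ` (no complex conjugation). -/
def conformality (φ ψ : FlatTorus Γ → ℂ) : FlatTorus Γ → ℂ :=
  descend (fun x => ∑ i, complexGradient (pull φ) x i * complexGradient (pull ψ) x i) (fun k hk x => by
    conv_rhs => rw [← pull_add φ hk, ← pull_add ψ hk]
    simp only [complexGradient, fderiv_comp_add_right])

/-- `F` is a `(lam, mu)`-eigenfamily on the torus. -/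
def IsEigenfamily (lam mu : ℂ) (F : Set (FlatTorus Γ → ℂ)) : Prop :=
  (∀ φ ∈ F, IsSmooth φ) ∧
  (∀ φ ∈ F, laplaceBeltrami φ = lam • φ) ∧
  (∀ φ ∈ F, ∀ ψ ∈ F, conformality φ ψ = mu • (φ * ψ))

/-- `φ` is a `(lam, mu)`-eigenfunction: it belongs to some `(lam, mu)`-eigenfamily. -/
def IsEigenfunction (lam mu : ℂ) (φ : FlatTorus Γ → ℂ) : Prop :=
  ∃ F : Set (FlatTorus Γ → ℂ), IsEigenfamily lam mu F ∧ φ ∈ F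

/-- The dual lattice `Γ* = {k' | ⟨k', k⟩ ∈ ℤ for all k ∈ Γ}`. -/
def dualLattice (Γ : Submodule ℤ (EuclideanSpace ℝ (Fin n))) :
    Submodule ℤ (EuclideanSpace ℝ (Fin n)) :=
  LinearMap.BilinForm.dualSubmodule (innerₗ (EuclideanSpace ℝ (Fin n))) Γ

lemma mem_dualLattice {k' : EuclideanSpace ℝ (Fin n)} :
    k' ∈ dualLattice Γ ↔ ∀ k ∈ Γ, ∃ m : ℤ, inner ℝ k' k = (m : ℝ) := by
  simp only [dualLattice, LinearMap.BilinForm.mem_dualSubmodule, Submodule.mem_one]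
  simp [eq_comm]

/-- The function `x ↦ exp(2πi⟨k', x⟩)` on the torus, for `k'` in the dual lattice. -/
def torusExp (k' : dualLattice Γ) : FlatTorus Γ → ℂ :=
  descend (fun x => Complex.exp
      (2 * Real.pi * Complex.I * (inner ℝ (k' : EuclideanSpace ℝ (Fin n)) x : ℝ)))
    (fun k hk x => by
      obtain ⟨m, hm⟩ := mem_dualLattice.1 k'.2 k hk
      rw [inner_add_right, hm, Complex.exp_eq_exp_iff_exists_int]
      exact ⟨m, by push_cast; ring⟩)

/-- The set of the functions `x ↦ exp(2πi⟨k', x⟩)` with `k' ∈ Γ*` and `‖k'‖² = -lam / (4π²)`. -/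
def expSet (Γ : Submodule ℤ (EuclideanSpace ℝ (Fin n))) (lam : ℂ) : Set (FlatTorus Γ → ℂ) :=
  {f | ∃ k' : dualLattice Γ,
    ((‖(k' : EuclideanSpace ℝ (Fin n))‖ ^ 2 : ℝ) : ℂ) = -lam / (4 * (Real.pi : ℂ) ^ 2) ∧
      f = torusExp k'}

end FlatTorusEigen

end

/-! Pull a nonzero member of the family back to a periodic `u` on ℝⁿ and study v = ∇u/u where u ≠ 0.
This field is curl-free, ∑ vᵢ² = mu, and div v = lam - mu. Differentiating ∑ vᵢ² twice gives, for
the Jacobian H of v, the Riccati equation DH = -H² with D = ∑ vᵢ∂ᵢ, hence D tr Hᵐ = -m tr Hᵐ⁺¹. As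
tr H is constant, all tr Hᵏ with k ≥ 2 vanish, and linear algebra then forces tr H = 0, that is lam
= mu (`eigenvalues_eq`). This half is local and does not use compactness.

Once lam = mu, |u|² is subharmonic, so it is constant by integration over a period
(`pd_mul_star_eq_zero`). Then u has no zeros, v is purely imaginary, and tr H² = -∑ |Hⱼₖ|² = 0 gives
H = 0. So v is constant and u is a multiple of a plane wave (`eq_planeWave`), whose wave vector is
in the dual lattice by periodicity. Finally, κ between two members forces their wave vectors to
coincide (`dual_eq_of_conformality`). -/

noncomputable section

namespace FlatTorusEigen

variable {n : ℕ} {Γ : Submodule ℤ (EuclideanSpace ℝ (Fin n))}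

/-! ### Calculus of partial derivatives of complex-valued functions -/

section PartialDerivatives

/-- The `i`-th partial derivative of a complex-valued function on `ℝⁿ`. -/
def pd (i : Fin n) (f : EuclideanSpace ℝ (Fin n) → ℂ) : EuclideanSpace ℝ (Fin n) → ℂ :=
  fun x => fderiv ℝ f x (EuclideanSpace.single i 1)

variable {f g : EuclideanSpace ℝ (Fin n) → ℂ} {x : EuclideanSpace ℝ (Fin n)}

lemma pd_congr (i : Fin n) (h : f =ᶠ[nhds x] g) : pd i f x = pd i g x := by
  simp only [pd, h.fderiv_eq]

lemma pd_const (i : Fin n) (c : ℂ) : pd i (fun _ => c) x = 0 := by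
  simp [pd]

lemma pd_add (i : Fin n) (hf : DifferentiableAt ℝ f x) (hg : DifferentiableAt ℝ g x) :
    pd i (fun y => f y + g y) x = pd i f x + pd i g x := by
  simp [pd, fderiv_fun_add hf hg]

lemma pd_mul (i : Fin n) (hf : DifferentiableAt ℝ f x) (hg : DifferentiableAt ℝ g x) :
    pd i (fun y => f y * g y) x = pd i f x * g x + f x * pd i g x := by
  simp [pd, fderiv_fun_mul hf hg]
  ring

lemma pd_const_mul (i : Fin n) (c : ℂ) (hf : DifferentiableAt ℝ f x) :
    pd i (fun y => c * f y) x = c * pd i f x := by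
  rw [pd_mul i (differentiableAt_const c) hf, pd_const, zero_mul, zero_add]

lemma pd_sum (i : Fin n) {ι : Type*} (s : Finset ι) {F : ι → EuclideanSpace ℝ (Fin n) → ℂ}
    (hF : ∀ j ∈ s, DifferentiableAt ℝ (F j) x) :
    pd i (fun y => ∑ j ∈ s, F j y) x = ∑ j ∈ s, pd i (F j) x := by
  simp [pd, fderiv_fun_sum hF]

lemma pd_star (i : Fin n) :
    pd i (fun y => star (f y)) x = star (pd i f x) := by
  simp only [pd, fderiv_star]
  rfl

lemma contDiffAt_pd (i : Fin n) (hf : ContDiffAt ℝ (⊤ : ℕ∞) f x) :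
    ContDiffAt ℝ (⊤ : ℕ∞) (pd i f) x :=
  (hf.fderiv_right (m := (⊤ : ℕ∞)) (by simp)).clm_apply contDiffAt_const

lemma contDiff_pd (i : Fin n) (hf : ContDiff ℝ (⊤ : ℕ∞) f) :
    ContDiff ℝ (⊤ : ℕ∞) (pd i f) :=
  contDiff_iff_contDiffAt.2 fun _ => contDiffAt_pd i hf.contDiffAt

lemma differentiableAt_of_smooth (hf : ContDiffAt ℝ (⊤ : ℕ∞) f x) : DifferentiableAt ℝ f x :=
  hf.differentiableAt (by simp)

lemma pd_pd_eq (i j : Fin n) (hf : ContDiffAt ℝ (⊤ : ℕ∞) f x) :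
    pd i (pd j f) x =
      fderiv ℝ (fderiv ℝ f) x (EuclideanSpace.single i 1) (EuclideanSpace.single j 1) := by
  have h : DifferentiableAt ℝ (fderiv ℝ f) x :=
    (hf.fderiv_right (m := (⊤ : ℕ∞)) (by simp)).differentiableAt (by simp)
  unfold pd
  rw [fderiv_clm_apply h (differentiableAt_const _)]
  simp

lemma pd_comm (i j : Fin n) (hf : ContDiffAt ℝ (⊤ : ℕ∞) f x) :
    pd i (pd j f) x = pd j (pd i f) x := by
  rw [pd_pd_eq i j hf, pd_pd_eq j i hf]
  refine (hf.isSymmSndFDerivAt ?_).eq _ _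
  rw [minSmoothness_of_isRCLikeNormedField]
  exact WithTop.coe_le_coe.2 le_top

lemma laplacian_eq_sum_pd (hf : ContDiff ℝ (⊤ : ℕ∞) f) (x : EuclideanSpace ℝ (Fin n)) :
    Laplacian.laplacian f x = ∑ i, pd i (pd i f) x := by
  rw [InnerProductSpace.laplacian_eq_iteratedFDeriv_orthonormalBasis f
    (EuclideanSpace.basisFun (Fin n) ℝ)]
  refine Finset.sum_congr rfl fun i _ => ?_
  rw [pd_pd_eq i i hf.contDiffAt, iteratedFDeriv_two_apply]
  simp

lemma eq_of_pd_eq_zero (hf : Differentiable ℝ f) (h : ∀ i x, pd i f x = 0)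
    (x y : EuclideanSpace ℝ (Fin n)) : f x = f y := by
  refine is_const_of_fderiv_eq_zero hf (fun z => ?_) x y
  ext w
  rw [← (EuclideanSpace.basisFun (Fin n) ℝ).sum_repr w, map_sum]
  refine Finset.sum_eq_zero fun i _ => ?_
  have := h i z
  simp only [pd] at this
  simp [this]

end PartialDerivatives

/-! ### Linear algebra: traces of powers -/

/-- A complex matrix whose powers of exponent at least two are traceless is traceless. -/
lemma trace_eq_zero_of_trace_pow (A : Matrix (Fin n) (Fin n) ℂ)
    (h : ∀ k, 2 ≤ k → (A ^ k).trace = 0) : A.trace = 0 := by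
  -- Split the characteristic polynomial as Xᵐ g with g(0) ≠ 0. By Cayley–Hamilton Aᵐ g(A) = 0, so A
  -- g(A) is nilpotent and hence traceless.
  obtain ⟨g, hg, hdvd⟩ := Polynomial.exists_eq_pow_rootMultiplicity_mul_and_not_dvd A.charpoly
    A.charpoly_monic.ne_zero 0
  set m := A.charpoly.rootMultiplicity 0
  rw [Polynomial.C_0, sub_zero] at hg hdvd
  have hg0 : g.coeff 0 ≠ 0 := fun h0 => hdvd (Polynomial.X_dvd_iff.2 h0)
  have hz : A ^ m * Polynomial.aeval A g = 0 := by
    have := A.aeval_self_charpoly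
    rw [hg] at this
    simpa using this
  have hcomm : Commute A (Polynomial.aeval A g) := by
    have := (Commute.all Polynomial.X g).map (Polynomial.aeval A)
    rwa [Polynomial.aeval_X] at this
  have hnil : IsNilpotent (A * Polynomial.aeval A g) := by
    refine ⟨m + 1, ?_⟩
    rw [hcomm.mul_pow, pow_succ A, pow_succ' (Polynomial.aeval A g), mul_assoc, ← mul_assoc A,
      hcomm.eq, mul_assoc, ← mul_assoc, hz, zero_mul]
  have htr := (Matrix.isNilpotent_trace_of_isNilpotent hnil).eq_zero
  -- The trace of A g(A) is g(0) tr A plus multiples of tr Aᵏ with k ≥ 2, so only g(0) tr A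
  -- survives.
  rw [Polynomial.aeval_eq_sum_range, Finset.mul_sum, Matrix.trace_sum,
    Finset.sum_range_succ', Finset.sum_eq_zero, zero_add] at htr
  · simpa [hg0] using htr
  · intro k _
    rw [mul_smul_comm, ← pow_succ', Matrix.trace_smul, h _ (by omega), smul_zero]

/-! ### The Riccati equation and its trace identities -/

section Riccati

/-- The Jacobian matrix of a complex vector field on `ℝⁿ`. -/
def jacobian (v : Fin n → EuclideanSpace ℝ (Fin n) → ℂ) (x : EuclideanSpace ℝ (Fin n)) :
    Matrix (Fin n) (Fin n) ℂ :=
  Matrix.of fun j k => pd k (v j) x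

variable {v : Fin n → EuclideanSpace ℝ (Fin n) → ℂ} {U : Set (EuclideanSpace ℝ (Fin n))} {mu c : ℂ}

lemma contDiffAt_jacobian_pow (hv : ∀ i, ∀ x ∈ U, ContDiffAt ℝ (⊤ : ℕ∞) (v i) x) (m : ℕ)
    (j k : Fin n) {x : EuclideanSpace ℝ (Fin n)} (hx : x ∈ U) :
    ContDiffAt ℝ (⊤ : ℕ∞) (fun y => (jacobian v y ^ m) j k) x := by
  induction m generalizing j k with
  | zero => simpa only [pow_zero] using contDiffAt_const
  | succ m ih =>
    simp only [pow_succ, Matrix.mul_apply]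
    exact ContDiffAt.sum fun i _ => (ih j i).mul (contDiffAt_pd k (hv i x hx))

/-- The Jacobian matrix `H` of a curl-free vector field `v` of constant (complex) length satisfies
the Riccati equation `D H = -H²`, where `D = ∑ᵢ vᵢ ∂ᵢ`. -/
lemma riccati (hU : IsOpen U) (hv : ∀ i, ∀ x ∈ U, ContDiffAt ℝ (⊤ : ℕ∞) (v i) x)
    (hsymm : ∀ x ∈ U, ∀ j k, pd k (v j) x = pd j (v k) x)
    (hlen : ∀ x ∈ U, ∑ i, v i x * v i x = mu) {x : EuclideanSpace ℝ (Fin n)} (hx : x ∈ U)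
    (j k : Fin n) :
    ∑ i, v i x * pd i (fun y => jacobian v y j k) x = -(jacobian v x ^ 2) j k := by
  have hnhds : U ∈ nhds x := hU.mem_nhds hx
  have hd : ∀ i, ∀ y ∈ U, DifferentiableAt ℝ (v i) y := fun i y hy =>
    differentiableAt_of_smooth (hv i y hy)
  have hdd : ∀ i l, DifferentiableAt ℝ (pd l (v i)) x := fun i l =>
    differentiableAt_of_smooth (contDiffAt_pd l (hv i x hx))
  have hfirst : ∀ y ∈ U, ∑ i, v i y * pd j (v i) y = 0 := by
    intro y hy
    have h1 : pd j (fun z => ∑ i, v i z * v i z) y = 0 := by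
      rw [pd_congr (g := fun _ => mu) j (Filter.eventually_of_mem (hU.mem_nhds hy) hlen), pd_const]
    rw [pd_sum j _ fun i _ => (hd i y hy).fun_mul (hd i y hy)] at h1
    simp only [pd_mul j (hd _ y hy) (hd _ y hy)] at h1
    have h2 : (2 : ℂ) * ∑ i, v i y * pd j (v i) y = 0 := by
      rw [← h1, Finset.mul_sum]
      exact Finset.sum_congr rfl fun i _ => by ring
    simpa using h2
  -- A second derivative of the constant length: by symmetry of H, the first summands add up to
  -- (H²)ⱼₖ and the second ones to (DH)ⱼₖ.
  have hsecond : ∑ i, (pd k (v i) x * pd j (v i) x + v i x * pd k (pd j (v i)) x) = 0 := by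
    have h1 : pd k (fun z => ∑ i, v i z * pd j (v i) z) x = 0 := by
      rw [pd_congr (g := fun _ => 0) k (Filter.eventually_of_mem hnhds hfirst), pd_const]
    rw [pd_sum k _ fun i _ => (hd i x hx).fun_mul (hdd i j)] at h1
    simpa only [pd_mul k (hd _ x hx) (hdd _ j)] using h1
  rw [Finset.sum_add_distrib] at hsecond
  rw [pow_two, Matrix.mul_apply, eq_neg_iff_add_eq_zero, ← hsecond, add_comm]
  congr 1
  · refine Finset.sum_congr rfl fun i _ => ?_
    simp only [jacobian, Matrix.of_apply]
    rw [hsymm x hx j i, mul_comm]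
  · refine Finset.sum_congr rfl fun i _ => ?_
    simp only [jacobian, Matrix.of_apply]
    rw [show (fun y => pd k (v j) y) = pd k (v j) from rfl, pd_comm i k (hv j x hx),
      pd_congr k (Filter.eventually_of_mem hnhds fun y hy => hsymm y hy j i)]

/-- D is a derivation and DH = -H² commutes with H, so the Leibniz rule acts on powers as in the
scalar case. -/
lemma riccati_pow (hU : IsOpen U) (hv : ∀ i, ∀ x ∈ U, ContDiffAt ℝ (⊤ : ℕ∞) (v i) x)
    (hsymm : ∀ x ∈ U, ∀ j k, pd k (v j) x = pd j (v k) x)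
    (hlen : ∀ x ∈ U, ∑ i, v i x * v i x = mu) {x : EuclideanSpace ℝ (Fin n)} (hx : x ∈ U)
    (m : ℕ) (j k : Fin n) :
    ∑ i, v i x * pd i (fun y => (jacobian v y ^ m) j k) x = -(m * (jacobian v x ^ (m + 1)) j k) := by
  induction m generalizing j k with
  | zero => simp [pd_const]
  | succ m ih =>
    have hp : ∀ a b, DifferentiableAt ℝ (fun y => (jacobian v y ^ m) a b) x := fun a b =>
      differentiableAt_of_smooth (contDiffAt_jacobian_pow hv m a b hx)
    have h1 : ∀ a b, DifferentiableAt ℝ (fun y => jacobian v y a b) x := fun a b =>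
      differentiableAt_of_smooth (contDiffAt_pd b (hv a x hx))
    simp only [pow_succ _ m, Matrix.mul_apply]
    simp only [pd_sum _ _ fun l _ => (hp j l).fun_mul (h1 l k), pd_mul _ (hp _ _) (h1 _ _)]
    calc ∑ i, v i x * ∑ l, (pd i (fun y => (jacobian v y ^ m) j l) x * jacobian v x l k +
            (jacobian v x ^ m) j l * pd i (fun y => jacobian v y l k) x)
        = ∑ l, ((∑ i, v i x * pd i (fun y => (jacobian v y ^ m) j l) x) * jacobian v x l k +
            (jacobian v x ^ m) j l * ∑ i, v i x * pd i (fun y => jacobian v y l k) x) := by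
          simp only [Finset.mul_sum, Finset.sum_mul, ← Finset.sum_add_distrib]
          rw [Finset.sum_comm]
          exact Finset.sum_congr rfl fun l _ => Finset.sum_congr rfl fun i _ => by ring
      _ = -(m * (jacobian v x ^ (m + 1) * jacobian v x) j k
            + (jacobian v x ^ m * jacobian v x ^ 2) j k) := by
          simp only [ih, riccati hU hv hsymm hlen hx, Matrix.mul_apply (M := jacobian v x ^ (m + 1)),
            Matrix.mul_apply (M := jacobian v x ^ m) (N := jacobian v x ^ 2), Finset.mul_sum,
            ← Finset.sum_add_distrib, ← Finset.sum_neg_distrib]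
          exact Finset.sum_congr rfl fun l _ => by ring
      _ = _ := by
          rw [← pow_succ, ← pow_add]
          push_cast
          ring

/-- Since D tr Hᵐ⁺¹ = -(m+1) tr Hᵐ⁺², a constant trace forces the next one to vanish. The constant
divergence tr H = c starts the induction. -/
lemma trace_jacobian_pow (hU : IsOpen U) (hv : ∀ i, ∀ x ∈ U, ContDiffAt ℝ (⊤ : ℕ∞) (v i) x)
    (hsymm : ∀ x ∈ U, ∀ j k, pd k (v j) x = pd j (v k) x)
    (hlen : ∀ x ∈ U, ∑ i, v i x * v i x = mu)
    (hdiv : ∀ x ∈ U, ∑ i, pd i (v i) x = c) (m : ℕ) :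
    ∀ x ∈ U, (jacobian v x ^ (m + 2)).trace = 0 := by
  have key : ∀ (m : ℕ) (c : ℂ), (∀ x ∈ U, (jacobian v x ^ (m + 1)).trace = c) →
      ∀ x ∈ U, (jacobian v x ^ (m + 2)).trace = 0 := by
    intro m c h x hx
    have hp : ∀ a, DifferentiableAt ℝ (fun y => (jacobian v y ^ (m + 1)) a a) x := fun a =>
      differentiableAt_of_smooth (contDiffAt_jacobian_pow hv (m + 1) a a hx)
    have h0 : ∀ i, ∑ a, pd i (fun y => (jacobian v y ^ (m + 1)) a a) x = 0 := by
      intro i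
      rw [← pd_sum i _ fun a _ => hp a]
      exact (pd_congr (g := fun _ => c) i (Filter.eventually_of_mem (hU.mem_nhds hx) h)).trans
        (pd_const i c)
    have h1 : ∑ a, ∑ i, v i x * pd i (fun y => (jacobian v y ^ (m + 1)) a a) x = 0 := by
      rw [Finset.sum_comm]
      simp only [← Finset.mul_sum, h0, mul_zero, Finset.sum_const_zero]
    simp only [riccati_pow hU hv hsymm hlen hx, Finset.sum_neg_distrib, ← Finset.mul_sum,
      neg_eq_zero, mul_eq_zero] at h1
    exact h1.resolve_left (Nat.cast_ne_zero.2 m.succ_ne_zero)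
  induction m with
  | zero => exact key 0 c fun x hx => by simpa [Matrix.trace, jacobian] using hdiv x hx
  | succ m ih => exact key (m + 1) 0 ih

/-- A curl-free complex vector field of constant length has zero divergence as soon as its
divergence is constant. -/
lemma divergence_eq_zero (hU : IsOpen U) (hne : U.Nonempty)
    (hv : ∀ i, ∀ x ∈ U, ContDiffAt ℝ (⊤ : ℕ∞) (v i) x)
    (hsymm : ∀ x ∈ U, ∀ j k, pd k (v j) x = pd j (v k) x)
    (hlen : ∀ x ∈ U, ∑ i, v i x * v i x = mu)
    (hdiv : ∀ x ∈ U, ∑ i, pd i (v i) x = c) : c = 0 := by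
  obtain ⟨x, hx⟩ := hne
  have h := trace_eq_zero_of_trace_pow (jacobian v x) fun k hk => by
    obtain ⟨m, rfl⟩ := Nat.exists_eq_add_of_le' hk
    exact trace_jacobian_pow hU hv hsymm hlen hdiv m x hx
  rw [← hdiv x hx, ← h]
  rfl

end Riccati

/-! ### The logarithmic gradient of an eigenfunction -/

section LogarithmicDerivative

variable {u : EuclideanSpace ℝ (Fin n) → ℂ} {lam mu : ℂ}

/-- The logarithmic gradient of `u`. -/
def logGrad (u : EuclideanSpace ℝ (Fin n) → ℂ) (i : Fin n) : EuclideanSpace ℝ (Fin n) → ℂ :=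
  fun x => pd i u x * (u x)⁻¹

lemma contDiffAt_logGrad (hu : ContDiff ℝ (⊤ : ℕ∞) u) (i : Fin n) {x : EuclideanSpace ℝ (Fin n)}
    (hx : u x ≠ 0) : ContDiffAt ℝ (⊤ : ℕ∞) (logGrad u i) x :=
  (contDiffAt_pd i hu.contDiffAt).mul (hu.contDiffAt.inv hx)

/-- Obtained by differentiating vⱼ u = ∂ⱼu. Both terms are symmetric in j and k, which makes v
curl-free; the trace gives its divergence. -/
lemma pd_logGrad (hu : ContDiff ℝ (⊤ : ℕ∞) u) (j k : Fin n) {x : EuclideanSpace ℝ (Fin n)}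
    (hx : u x ≠ 0) :
    pd k (logGrad u j) x = pd k (pd j u) x * (u x)⁻¹ - logGrad u j x * logGrad u k x := by
  have h : pd k (fun y => logGrad u j y * u y) x = pd k (pd j u) x := by
    refine pd_congr k ?_
    filter_upwards [hu.continuous.continuousAt.eventually_ne hx] with y hy
    simp [logGrad, hy]
  rw [pd_mul k (differentiableAt_of_smooth (contDiffAt_logGrad hu j hx))
    (differentiableAt_of_smooth hu.contDiffAt)] at h
  rw [← h]
  simp only [logGrad]
  field_simp
  ring

lemma pd_logGrad_symm (hu : ContDiff ℝ (⊤ : ℕ∞) u) {x : EuclideanSpace ℝ (Fin n)}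
    (hx : u x ≠ 0) (j k : Fin n) : pd k (logGrad u j) x = pd j (logGrad u k) x := by
  rw [pd_logGrad hu j k hx, pd_logGrad hu k j hx, pd_comm k j hu.contDiffAt, mul_comm (logGrad u j x)]

lemma sum_logGrad_sq (hmu : ∀ x, ∑ i, pd i u x * pd i u x = mu * (u x * u x))
    {x : EuclideanSpace ℝ (Fin n)} (hx : u x ≠ 0) : ∑ i, logGrad u i x * logGrad u i x = mu := by
  have : ∑ i, logGrad u i x * logGrad u i x = (∑ i, pd i u x * pd i u x) * ((u x)⁻¹ * (u x)⁻¹) := by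
    rw [Finset.sum_mul]
    exact Finset.sum_congr rfl fun i _ => by simp only [logGrad]; ring
  rw [this, hmu]
  field_simp

lemma sum_pd_logGrad (hu : ContDiff ℝ (⊤ : ℕ∞) u) (hlam : ∀ x, ∑ i, pd i (pd i u) x = lam * u x)
    (hmu : ∀ x, ∑ i, pd i u x * pd i u x = mu * (u x * u x))
    {x : EuclideanSpace ℝ (Fin n)} (hx : u x ≠ 0) : ∑ i, pd i (logGrad u i) x = lam - mu := by
  simp only [pd_logGrad hu _ _ hx, Finset.sum_sub_distrib, ← Finset.sum_mul, sum_logGrad_sq hmu hx,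
    hlam]
  field_simp

/-- The two eigenvalues of a nonzero eigenfunction agree. -/
lemma eigenvalues_eq (hu : ContDiff ℝ (⊤ : ℕ∞) u) (hlam : ∀ x, ∑ i, pd i (pd i u) x = lam * u x)
    (hmu : ∀ x, ∑ i, pd i u x * pd i u x = mu * (u x * u x)) (hne : ∃ x, u x ≠ 0) : lam = mu :=
  sub_eq_zero.1 <| divergence_eq_zero (U := {x | u x ≠ 0})
    (isOpen_ne_fun hu.continuous continuous_const) hne
    (fun i _ hx => contDiffAt_logGrad hu i hx) (fun _ hx => pd_logGrad_symm hu hx)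
    (fun _ hx => sum_logGrad_sq hmu hx) (fun _ hx => sum_pd_logGrad hu hlam hmu hx)

end LogarithmicDerivative

/-! ### Integration over a period -/

section Integration

open MeasureTheory

lemma pd_periodic (i : Fin n) {g : EuclideanSpace ℝ (Fin n) → ℂ}
    (hg : ∀ k ∈ Γ, ∀ x, g (x + k) = g x) : ∀ k ∈ Γ, ∀ x, pd i g (x + k) = pd i g x := by
  intro k hk x
  have h : (fun y => g (y + k)) = g := funext (hg k hk)
  conv_rhs => rw [← h]
  simp only [pd, fderiv_comp_add_right]

instance vaddInvariantMeasure_submodule :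
    VAddInvariantMeasure Γ (EuclideanSpace ℝ (Fin n)) volume :=
  ⟨fun k s _ => measure_preimage_add volume (k : EuclideanSpace ℝ (Fin n)) s⟩

/-- The translate of a fundamental domain is again one, and a periodic function has the same
integral over both. -/
lemma setIntegral_translate_eq [Countable Γ] {D : Set (EuclideanSpace ℝ (Fin n))}
    (hD : IsAddFundamentalDomain Γ D volume) {g : EuclideanSpace ℝ (Fin n) → ℂ}
    (hg : ∀ k ∈ Γ, ∀ x, g (x + k) = g x) (a : EuclideanSpace ℝ (Fin n)) :
    ∫ x in D, g (x + a) = ∫ x in D, g x := by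
  have hinv : ∀ (k : Γ) (x : EuclideanSpace ℝ (Fin n)), g (k +ᵥ x) = g x := fun k x => by
    rw [Submodule.vadd_def, vadd_eq_add, add_comm]
    exact hg k k.2 x
  rw [← (hD.vadd_of_comm a).setIntegral_eq hD hinv]
  have hmp : MeasurePreserving (fun x : EuclideanSpace ℝ (Fin n) => a + x) volume volume :=
    measurePreserving_add_left volume a
  have hemb : MeasurableEmbedding (fun x : EuclideanSpace ℝ (Fin n) => a + x) :=
    (MeasurableEquiv.addLeft a).measurableEmbedding
  rw [← Set.image_vadd]
  simp only [vadd_eq_add]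
  rw [hmp.setIntegral_image_emb hemb]
  simp only [add_comm]

/-- The integral of a partial derivative of a smooth periodic function over a period vanishes. -/
lemma setIntegral_pd_eq_zero [Countable Γ] {D : Set (EuclideanSpace ℝ (Fin n))}
    (hD : IsAddFundamentalDomain Γ D volume) (hbdd : Bornology.IsBounded D)
    {g : EuclideanSpace ℝ (Fin n) → ℂ} (hs : ContDiff ℝ (⊤ : ℕ∞) g)
    (hg : ∀ k ∈ Γ, ∀ x, g (x + k) = g x) (i : Fin n) : ∫ x in D, pd i g x = 0 := by
  set e : EuclideanSpace ℝ (Fin n) := EuclideanSpace.single i 1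
  have hfin : volume D < ⊤ := hbdd.measure_lt_top
  have : IsFiniteMeasure (volume.restrict D) := ⟨by simpa using hfin⟩
  obtain ⟨R, hR⟩ := hbdd.subset_closedBall 0
  have hcont : Continuous (pd i g) := (contDiff_pd i hs).continuous
  -- The radius R + ‖e‖ leaves room for all x + t e with x in D and |t| < 1.
  obtain ⟨C, hC⟩ := (isCompact_closedBall (0 : EuclideanSpace ℝ (Fin n)) (R + ‖e‖)
    ).exists_bound_of_continuousOn hcont.continuousOn
  obtain ⟨C', hC'⟩ := (isCompact_closedBall (0 : EuclideanSpace ℝ (Fin n)) R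
    ).exists_bound_of_continuousOn hs.continuous.continuousOn
  have hDm : ∀ᵐ x ∂volume.restrict D, x ∈ D := ae_restrict_mem₀ hD.nullMeasurableSet
  -- Differentiate t ↦ ∫_D g(x + t e) under the integral sign at t = 0; by translation invariance it
  -- is constant.
  have key := (hasDerivAt_integral_of_dominated_loc_of_deriv_le (μ := volume.restrict D)
    (F := fun (t : ℝ) x => g (x + t • e)) (F' := fun (t : ℝ) x => pd i g (x + t • e))
    (x₀ := 0) (s := Metric.ball 0 1) (bound := fun _ => C)
    (Metric.ball_mem_nhds 0 one_pos) ?_ ?_ ?_ ?_ ?_ ?_).2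
  · simp only [setIntegral_translate_eq hD hg, zero_smul, add_zero] at key
    exact key.unique (hasDerivAt_const _ _)
  · exact Filter.Eventually.of_forall fun t =>
      (hs.continuous.comp (by fun_prop)).aestronglyMeasurable
  · simp only [zero_smul, add_zero]
    refine Integrable.of_bound hs.continuous.aestronglyMeasurable C' ?_
    filter_upwards [hDm] with x hx using hC' x (hR hx)
  · exact (hcont.comp (by fun_prop)).aestronglyMeasurable
  · filter_upwards [hDm] with x hx t ht
    refine hC _ ?_
    have h1 : ‖x‖ ≤ R := by simpa using hR hx
    have h2 : |t| ≤ 1 := by simpa using (mem_ball_zero_iff.1 ht).le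
    rw [mem_closedBall_zero_iff]
    refine (norm_add_le _ _).trans (add_le_add h1 ?_)
    rw [norm_smul, Real.norm_eq_abs]
    exact mul_le_of_le_one_left (norm_nonneg _) h2
  · exact integrable_const _
  · refine Filter.Eventually.of_forall fun x t _ => ?_
    have h1 : HasFDerivAt g (fderiv ℝ g (x + t • e)) (x + t • e) :=
      (hs.differentiable (by simp) _).hasFDerivAt
    have h2 : HasDerivAt (fun s : ℝ => x + s • e) e t := by
      simpa using ((hasDerivAt_id t).smul_const e).const_add x
    exact h1.comp_hasDerivAt t h2

/-- A nonnegative function that is the Laplacian of a smooth periodic function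
vanishes. -/
lemma eq_zero_of_nonneg_laplacian [DiscreteTopology Γ] [IsZLattice ℝ Γ]
    {g : EuclideanSpace ℝ (Fin n) → ℂ} (hs : ContDiff ℝ (⊤ : ℕ∞) g)
    (hg : ∀ k ∈ Γ, ∀ x, g (x + k) = g x) {h : EuclideanSpace ℝ (Fin n) → ℝ}
    (hh : ∀ x, 0 ≤ h x) (hgh : ∀ x, ∑ i, pd i (pd i g) x = h x)
    (x : EuclideanSpace ℝ (Fin n)) : h x = 0 := by
  have hss : ∀ i, ContDiff ℝ (⊤ : ℕ∞) (pd i (pd i g)) := fun i => contDiff_pd i (contDiff_pd i hs)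
  have hhre : h = fun x => (∑ i, pd i (pd i g) x).re := funext fun x => by rw [hgh]; simp
  have hcont : Continuous h := by
    rw [hhre]
    exact Complex.continuous_re.comp (continuous_finsetSum _ fun i _ => (hss i).continuous)
  have hper : ∀ k ∈ Γ, ∀ x, h (x + k) = h x := fun k hk x => by
    simp only [hhre, pd_periodic _ (pd_periodic _ hg) k hk x]
  let b := Module.Free.chooseBasis ℤ Γ
  set D := ZSpan.fundamentalDomain (b.ofZLatticeBasis ℝ Γ)
  have hD : IsAddFundamentalDomain Γ D volume := ZLattice.isAddFundamentalDomain b volume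
  have hbdd : Bornology.IsBounded D := ZSpan.fundamentalDomain_isBounded _
  have hint : ∀ {G : Type} [NormedAddCommGroup G] {f : EuclideanSpace ℝ (Fin n) → G},
      Continuous f → IntegrableOn f D volume := fun hf =>
    (hf.continuousOn.integrableOn_compact hbdd.isCompact_closure).mono_set subset_closure
  have h0 : ∫ x in D, h x = 0 := by
    have h1 : ((∫ x in D, h x : ℝ) : ℂ) = 0 := by
      rw [← integral_complex_ofReal]
      simp only [← hgh]
      rw [integral_finsetSum _ fun i _ => hint (hss i).continuous]
      exact Finset.sum_eq_zero fun i _ =>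
        setIntegral_pd_eq_zero hD hbdd (contDiff_pd i hs) (pd_periodic i hg) i
    exact_mod_cast h1
  rw [setIntegral_eq_zero_iff_of_nonneg_ae (Filter.Eventually.of_forall hh) (hint hcont)] at h0
  -- The zero integral gives h = 0 almost everywhere on D; periodicity extends this to ℝⁿ, and
  -- continuity removes the null set.
  have hnull : volume {x | h x ≠ 0} = 0 := by
    refine hD.measure_zero_of_invariant _ (fun k => ?_) ?_
    · ext x
      rw [Set.mem_vadd_set_iff_neg_vadd_mem, Submodule.vadd_def, vadd_eq_add, add_comm]
      simp only [Set.mem_ofPred_eq]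
      rw [hper _ (-k).2]
    · rw [← Measure.restrict_apply (isOpen_ne_fun hcont continuous_const).measurableSet]
      exact h0
  exact congrFun ((hcont.ae_eq_iff_eq (g := fun _ => (0 : ℝ)) volume continuous_const).1 hnull) x

end Integration

/-! ### Plane waves -/

section Exponentials

/-- The function `x ↦ exp(2πi⟨k, x⟩)` on `ℝⁿ`. -/
def planeWave (k x : EuclideanSpace ℝ (Fin n)) : ℂ :=
  Complex.exp (2 * Real.pi * Complex.I * (inner ℝ k x : ℝ))

lemma pull_torusExp (k : dualLattice Γ) :
    pull (torusExp k) = planeWave (k : EuclideanSpace ℝ (Fin n)) := rfl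

lemma contDiff_planeWave (k : EuclideanSpace ℝ (Fin n)) :
    ContDiff ℝ (⊤ : ℕ∞) (planeWave k) := by
  unfold planeWave
  refine ContDiff.cexp (contDiff_const.mul (Complex.ofRealCLM.contDiff.comp ?_))
  exact contDiff_const.inner ℝ contDiff_id

lemma pd_planeWave (k : EuclideanSpace ℝ (Fin n)) (i : Fin n) (x : EuclideanSpace ℝ (Fin n)) :
    pd i (planeWave k) x = 2 * Real.pi * Complex.I * (k i : ℝ) * planeWave k x := by
  have h1 : HasFDerivAt (fun y : EuclideanSpace ℝ (Fin n) => ((inner ℝ k y : ℝ) : ℂ))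
      (Complex.ofRealCLM.comp (innerSL ℝ k)) x :=
    (Complex.ofRealCLM.comp (innerSL ℝ k)).hasFDerivAt
  have h2 := (h1.const_mul (2 * Real.pi * Complex.I)).cexp
  change fderiv ℝ (fun y => Complex.exp (2 * Real.pi * Complex.I * (inner ℝ k y : ℝ))) x _ = _
  rw [h2.fderiv]
  simp [planeWave, EuclideanSpace.inner_single_right]
  ring

lemma pd_pd_planeWave (k : EuclideanSpace ℝ (Fin n)) (i j : Fin n)
    (x : EuclideanSpace ℝ (Fin n)) :
    pd j (pd i (planeWave k)) x = 2 * Real.pi * Complex.I * (k i : ℝ) *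
      (2 * Real.pi * Complex.I * (k j : ℝ) * planeWave k x) := by
  rw [show pd i (planeWave k) = fun y => 2 * Real.pi * Complex.I * (k i : ℝ) * planeWave k y from
    funext (pd_planeWave k i), pd_const_mul j _ (differentiableAt_of_smooth
      (contDiff_planeWave k).contDiffAt), pd_planeWave]

lemma sum_sq_coord (k : EuclideanSpace ℝ (Fin n)) :
    ∑ i, (2 * Real.pi * Complex.I * (k i : ℝ)) * (2 * Real.pi * Complex.I * (k i : ℝ)) =
      -(4 * (Real.pi : ℂ) ^ 2) * ((‖k‖ ^ 2 : ℝ) : ℂ) := by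
  rw [EuclideanSpace.real_norm_sq_eq, Complex.ofReal_sum, Finset.mul_sum]
  refine Finset.sum_congr rfl fun i _ => ?_
  push_cast
  linear_combination (4 * (Real.pi : ℂ) ^ 2 * (k i : ℂ) ^ 2) * Complex.I_sq

lemma eq_of_norm_sq_eq {k : EuclideanSpace ℝ (Fin n)} {lam : ℂ}
    (hk : ((‖k‖ ^ 2 : ℝ) : ℂ) = -lam / (4 * (Real.pi : ℂ) ^ 2)) :
    lam = -(4 * (Real.pi : ℂ) ^ 2) * ((‖k‖ ^ 2 : ℝ) : ℂ) := by
  have hpi : (Real.pi : ℂ) ≠ 0 := Complex.ofReal_ne_zero.2 Real.pi_ne_zero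
  rw [hk]
  field_simp

end Exponentials

/-! ### Eigenfamily equations on ℝⁿ, and plane waves as solutions -/

section Equations

lemma isSmooth_torusExp (k : dualLattice Γ) : IsSmooth (torusExp k) :=
  contDiff_planeWave _

lemma proj_surjective (p : FlatTorus Γ) : ∃ x, proj Γ x = p :=
  Submodule.Quotient.mk_surjective Γ p

lemma laplaceBeltrami_eq_iff {φ : FlatTorus Γ → ℂ} (hφ : IsSmooth φ) {lam : ℂ} :
    laplaceBeltrami φ = lam • φ ↔ ∀ x, ∑ i, pd i (pd i (pull φ)) x = lam * pull φ x := by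
  refine ⟨fun h x => ?_, fun h => funext fun p => ?_⟩
  · rw [← laplacian_eq_sum_pd hφ]
    exact congrFun h (proj Γ x)
  · obtain ⟨x, rfl⟩ := proj_surjective p
    exact (laplacian_eq_sum_pd hφ x).trans (h x)

lemma conformality_eq_iff {φ ψ : FlatTorus Γ → ℂ} {mu : ℂ} :
    conformality φ ψ = mu • (φ * ψ) ↔
      ∀ x, ∑ i, pd i (pull φ) x * pd i (pull ψ) x = mu * (pull φ x * pull ψ x) := by
  refine ⟨fun h x => congrFun h (proj Γ x), fun h => funext fun p => ?_⟩
  obtain ⟨x, rfl⟩ := proj_surjective p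
  exact h x

lemma isEigenfunction_of_mem_expSet {lam : ℂ} {f : FlatTorus Γ → ℂ} (hf : f ∈ expSet Γ lam) :
    IsEigenfunction lam lam f := by
  obtain ⟨k, hk, rfl⟩ := hf
  refine ⟨{torusExp k}, ⟨?_, ?_, ?_⟩, rfl⟩
  · rintro _ rfl
    exact isSmooth_torusExp k
  · rintro _ rfl
    rw [laplaceBeltrami_eq_iff (isSmooth_torusExp k), pull_torusExp]
    intro x
    simp only [pd_pd_planeWave, ← mul_assoc, ← Finset.sum_mul]
    rw [eq_of_norm_sq_eq hk, ← sum_sq_coord]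
    simp only [← mul_assoc]
  · rintro _ rfl _ rfl
    rw [conformality_eq_iff, pull_torusExp]
    intro x
    simp only [pd_planeWave]
    rw [eq_of_norm_sq_eq hk, ← sum_sq_coord, Finset.sum_mul]
    exact Finset.sum_congr rfl fun i _ => by ring

end Equations

/-! ### Constant modulus and classification -/

section Classification

variable {u : EuclideanSpace ℝ (Fin n) → ℂ} {lam : ℂ}

lemma pd_pd_mul {a b : EuclideanSpace ℝ (Fin n) → ℂ} (ha : ContDiff ℝ (⊤ : ℕ∞) a)
    (hb : ContDiff ℝ (⊤ : ℕ∞) b) (i : Fin n) (x : EuclideanSpace ℝ (Fin n)) :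
    pd i (pd i (fun y => a y * b y)) x =
      pd i (pd i a) x * b x + 2 * (pd i a x * pd i b x) + a x * pd i (pd i b) x := by
  have hd : ∀ {c : EuclideanSpace ℝ (Fin n) → ℂ}, ContDiff ℝ (⊤ : ℕ∞) c →
      ∀ y, DifferentiableAt ℝ c y := fun hc y => differentiableAt_of_smooth hc.contDiffAt
  have ha' := contDiff_pd i ha
  have hb' := contDiff_pd i hb
  rw [show pd i (fun y => a y * b y) = fun y => pd i a y * b y + a y * pd i b y from
    funext fun y => pd_mul i (hd ha y) (hd hb y),
    pd_add i ((hd ha' x).fun_mul (hd hb x)) ((hd ha x).fun_mul (hd hb' x)),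
    pd_mul i (hd ha' x) (hd hb x), pd_mul i (hd ha x) (hd hb' x)]
  ring

lemma contDiff_star_comp (hu : ContDiff ℝ (⊤ : ℕ∞) u) :
    ContDiff ℝ (⊤ : ℕ∞) fun y => star (u y) :=
  Complex.conjCLE.contDiff.comp hu

lemma pd_mul_star (hu : ContDiff ℝ (⊤ : ℕ∞) u) (i : Fin n) (x : EuclideanSpace ℝ (Fin n)) :
    pd i (fun y => u y * star (u y)) x = ((2 * (pd i u x * star (u x)).re : ℝ) : ℂ) := by
  have hd := differentiableAt_of_smooth (hu.contDiffAt (x := x))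
  rw [pd_mul i hd hd.star, pd_star]
  apply Complex.ext <;> simp <;> ring

/-- In the Leibniz rule for u ū the outer terms give (lam + conj lam)|u|² and the cross terms give
2∑ |∂ᵢu|². -/
lemma laplacian_mul_star (hu : ContDiff ℝ (⊤ : ℕ∞) u)
    (hlam : ∀ x, ∑ i, pd i (pd i u) x = lam * u x) (x : EuclideanSpace ℝ (Fin n)) :
    ∑ i, pd i (pd i (fun y => u y * star (u y))) x =
      ((2 * (lam.re * ‖u x‖ ^ 2 + ∑ i, ‖pd i u x‖ ^ 2) : ℝ) : ℂ) := by
  have hus : ContDiff ℝ (⊤ : ℕ∞) fun y => star (u y) := (contDiff_star_comp hu)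
  have hstar : ∀ i, pd i (fun y => star (u y)) = fun y => star (pd i u y) := fun i =>
    funext fun y => pd_star i
  have hsq : ∀ z : ℂ, z * star z = ((‖z‖ ^ 2 : ℝ) : ℂ) := fun z => by
    rw [Complex.star_def, Complex.mul_conj, Complex.normSq_eq_norm_sq]
  simp only [pd_pd_mul hu hus, hstar, pd_star, Finset.sum_add_distrib, ← Finset.mul_sum,
    ← Finset.sum_mul, ← star_sum, hlam]
  simp only [hsq]
  rw [star_mul', mul_assoc, hsq, mul_left_comm, hsq, Complex.star_def]
  have hre : lam + (starRingEnd ℂ) lam = ((2 * lam.re : ℝ) : ℂ) := Complex.add_conj lam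
  push_cast at hre ⊢
  linear_combination ((‖u x‖ : ℂ) ^ 2) * hre

/-- If the two eigenvalues agree, then the modulus of the eigenfunction is constant: its square is
subharmonic and periodic. -/
lemma pd_mul_star_eq_zero [DiscreteTopology Γ] [IsZLattice ℝ Γ] (hu : ContDiff ℝ (⊤ : ℕ∞) u)
    (hper : ∀ k ∈ Γ, ∀ x, u (x + k) = u x)
    (hlam : ∀ x, ∑ i, pd i (pd i u) x = lam * u x)
    (hmu : ∀ x, ∑ i, pd i u x * pd i u x = lam * (u x * u x)) (i : Fin n)
    (x : EuclideanSpace ℝ (Fin n)) : pd i (fun y => u y * star (u y)) x = 0 := by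
  set f : EuclideanSpace ℝ (Fin n) → ℂ := fun y => u y * star (u y) with hf
  have hfs : ContDiff ℝ (⊤ : ℕ∞) f := hu.mul (contDiff_star_comp hu)
  have hfval : ∀ y, f y = ((‖u y‖ ^ 2 : ℝ) : ℂ) := fun y => by
    rw [hf, ← Complex.normSq_eq_norm_sq, ← Complex.mul_conj, Complex.star_def]
  set L : EuclideanSpace ℝ (Fin n) → ℝ := fun y =>
    2 * (lam.re * ‖u y‖ ^ 2 + ∑ i, ‖pd i u y‖ ^ 2) with hL
  have hLpos : ∀ y, 0 ≤ L y := by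
    intro y
    -- The triangle inequality for ∑ (∂ᵢu)² = lam u²; with Re lam ≥ -|lam| it yields subharmonicity.
    have h1 : ‖lam‖ * ‖u y‖ ^ 2 ≤ ∑ i, ‖pd i u y‖ ^ 2 := by
      calc ‖lam‖ * ‖u y‖ ^ 2 = ‖∑ i, pd i u y * pd i u y‖ := by
            rw [hmu, norm_mul, norm_mul, sq]
        _ ≤ ∑ i, ‖pd i u y * pd i u y‖ := norm_sum_le _ _
        _ = _ := Finset.sum_congr rfl fun i _ => by rw [norm_mul, sq]
    have h2 : -‖lam‖ ≤ lam.re := (abs_le.1 (Complex.abs_re_le_norm lam)).1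
    have h3 := mul_le_mul_of_nonneg_right h2 (sq_nonneg ‖u y‖)
    simp only [hL]
    linarith
  -- Using f² instead of f = |u|² brings in the gradient: Δ(f²) = 2fΔf + 2∑ (∂ᵢf)² has nonnegative
  -- terms, so its vanishing kills ∇f.
  have hzero := eq_zero_of_nonneg_laplacian (Γ := Γ) (g := fun y => f y * f y) (hfs.mul hfs)
    (fun k hk y => by simp only [hf, hper k hk y])
    (h := fun y => 2 * (‖u y‖ ^ 2 * L y) + 2 * ∑ i, (2 * (pd i u y * star (u y)).re) ^ 2)
    (fun y => by have := hLpos y; positivity)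
    (fun y => by
      simp only [pd_pd_mul hfs hfs, Finset.sum_add_distrib, ← Finset.mul_sum, ← Finset.sum_mul]
      rw [laplacian_mul_star hu hlam, hfval]
      simp only [hf, pd_mul_star hu, hL]
      push_cast
      simp only [← sq]
      ring) x
  have h1 : 0 ≤ ‖u x‖ ^ 2 * L x := mul_nonneg (sq_nonneg _) (hLpos x)
  have h2 : ∀ j ∈ Finset.univ, 0 ≤ (2 * (pd j u x * star (u x)).re) ^ 2 := fun j _ => sq_nonneg _
  have h3 : ∑ j, (2 * (pd j u x * star (u x)).re) ^ 2 = 0 := by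
    have := Finset.sum_nonneg h2
    linarith
  have h4 := (Finset.sum_eq_zero_iff_of_nonneg h2).1 h3 i (Finset.mem_univ i)
  rw [pd_mul_star hu, pow_eq_zero_iff two_ne_zero |>.1 h4, Complex.ofReal_zero]

/-- A nonzero periodic eigenfunction whose eigenvalues agree is a multiple of a plane wave. -/
lemma eq_planeWave [DiscreteTopology Γ] [IsZLattice ℝ Γ] (hu : ContDiff ℝ (⊤ : ℕ∞) u)
    (hper : ∀ k ∈ Γ, ∀ x, u (x + k) = u x)
    (hlam : ∀ x, ∑ i, pd i (pd i u) x = lam * u x)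
    (hmu : ∀ x, ∑ i, pd i u x * pd i u x = lam * (u x * u x)) (hne : ∃ x, u x ≠ 0) :
    ∃ k : EuclideanSpace ℝ (Fin n), lam = -(4 * (Real.pi : ℂ) ^ 2) * ((‖k‖ ^ 2 : ℝ) : ℂ) ∧
      u 0 ≠ 0 ∧ ∀ x, u x = u 0 * planeWave k x := by
  have hpi : (Real.pi : ℂ) ≠ 0 := Complex.ofReal_ne_zero.2 Real.pi_ne_zero
  have hpd := fun i x => pd_mul_star_eq_zero hu hper hlam hmu i x
  obtain ⟨x₀, hx₀⟩ := hne
  have hne : ∀ x, u x ≠ 0 := by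
    intro x hx
    have h := eq_of_pd_eq_zero ((hu.mul (contDiff_star_comp hu)).differentiable (by simp)) hpd x₀ x
    rw [hx, zero_mul] at h
    simp [hx₀] at h
  -- Constancy of |u|² says Re(∂ᵢu · ū) = 0, so the logarithmic gradient is purely imaginary, and so
  -- is its Jacobian.
  have hv : ∀ i x, star (logGrad u i x) = -logGrad u i x := by
    intro i x
    have hd := differentiableAt_of_smooth (hu.contDiffAt (x := x))
    have h := hpd i x
    rw [pd_mul i hd hd.star, pd_star] at h
    have hs : star (u x) ≠ 0 := star_ne_zero.2 (hne x)
    have h0 := hne x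
    simp only [logGrad, star_mul', star_inv₀]
    field_simp
    linear_combination h
  have hH : ∀ j k x, star (pd k (logGrad u j) x) = -pd k (logGrad u j) x := by
    intro j k x
    rw [← pd_star, show (fun y => star (logGrad u j y)) = fun y => (-1) * logGrad u j y from
      funext fun y => by rw [hv]; ring, pd_const_mul k _ (differentiableAt_of_smooth
        (contDiffAt_logGrad hu j (hne x)))]
    ring
  have htr : ∀ x, (jacobian (logGrad u) x ^ 2).trace = 0 := fun x =>
    trace_jacobian_pow isOpen_univ (fun i x _ => contDiffAt_logGrad hu i (hne x))
      (fun x _ => pd_logGrad_symm hu (hne x)) (fun x _ => sum_logGrad_sq hmu (hne x))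
      (fun x _ => sum_pd_logGrad hu hlam hmu (hne x)) 0 x (Set.mem_univ x)
  have hH0 : ∀ j k x, pd k (logGrad u j) x = 0 := by
    intro j k x
    have h1 : ∑ a, ∑ b, ‖pd b (logGrad u a) x‖ ^ 2 = 0 := by
      have h2 := htr x
      simp only [sq, Matrix.trace, Matrix.diag_apply, Matrix.mul_apply, jacobian,
        Matrix.of_apply] at h2
      -- H is symmetric with imaginary entries, so each product in tr H² is -|H_ab|².
      have h3 : ∀ a b, pd b (logGrad u a) x * pd a (logGrad u b) x =
          ((-‖pd b (logGrad u a) x‖ ^ 2 : ℝ) : ℂ) := by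
        intro a b
        rw [← pd_logGrad_symm hu (hne x) a b, ← Complex.normSq_eq_norm_sq, Complex.ofReal_neg,
          ← Complex.mul_conj, ← Complex.star_def, hH]
        ring
      simp only [h3, ← Complex.ofReal_sum, Complex.ofReal_eq_zero, Finset.sum_neg_distrib,
        neg_eq_zero] at h2
      exact h2
    have h4 := (Finset.sum_eq_zero_iff_of_nonneg fun a _ =>
      Finset.sum_nonneg fun b _ => sq_nonneg _).1 h1 j (Finset.mem_univ j)
    have h5 := (Finset.sum_eq_zero_iff_of_nonneg fun b _ => sq_nonneg _).1 h4 k (Finset.mem_univ k)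
    simpa using h5
  have hconst : ∀ j x, logGrad u j x = logGrad u j 0 := fun j x =>
    eq_of_pd_eq_zero (fun y => differentiableAt_of_smooth (contDiffAt_logGrad hu j (hne y)))
      (fun k y => hH0 j k y) x 0
  -- The wave vector is v/(2πi), real because v is imaginary.
  let k : EuclideanSpace ℝ (Fin n) := WithLp.toLp 2 fun j => (logGrad u j 0).im / (2 * Real.pi)
  have hk : ∀ j, logGrad u j 0 = 2 * Real.pi * Complex.I * (k j : ℝ) := by
    intro j
    have hre : (logGrad u j 0).re = 0 := by
      have := congrArg Complex.re (hv j 0)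
      simp at this
      linarith
    have hkj : k j = (logGrad u j 0).im / (2 * Real.pi) := rfl
    rw [hkj]
    conv_lhs => rw [← Complex.re_add_im (logGrad u j 0), hre]
    push_cast
    field_simp
    ring
  have hneg : ∀ x, planeWave (-k) x * planeWave k x = 1 := fun x => by
    rw [planeWave, planeWave, ← Complex.exp_add, inner_neg_left, Complex.ofReal_neg]
    simp
  refine ⟨k, ?_, hne 0, fun x => ?_⟩
  · rw [← sum_sq_coord, ← sum_logGrad_sq hmu (hne 0)]
    exact Finset.sum_congr rfl fun j _ => by rw [hk]
  -- Multiplying u by the inverse wave gives a function with zero gradient.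
  · have hw := contDiff_planeWave (-k)
    have h := eq_of_pd_eq_zero (f := fun y => u y * planeWave (-k) y)
      ((hu.mul hw).differentiable (by simp)) (fun i y => by
        have h1 : pd i u y = 2 * Real.pi * Complex.I * (k i : ℝ) * u y := by
          rw [← hk, ← hconst i y, logGrad, inv_mul_cancel_right₀ (hne y)]
        rw [pd_mul i (differentiableAt_of_smooth hu.contDiffAt)
          (differentiableAt_of_smooth hw.contDiffAt), pd_planeWave, h1]
        simp only [PiLp.neg_apply, Complex.ofReal_neg]
        ring) x 0
    have h0 : planeWave (-k) 0 = 1 := by simp [planeWave]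
    rw [h0, mul_one] at h
    rw [← h, mul_assoc, hneg, mul_one]

lemma exists_eq_smul_torusExp [DiscreteTopology Γ] [IsZLattice ℝ Γ] {mu : ℂ}
    {F : Set (FlatTorus Γ → ℂ)} (hF : IsEigenfamily lam mu F) {φ : FlatTorus Γ → ℂ} (hφ : φ ∈ F)
    (hne : φ ≠ 0) :
    lam = mu ∧ ∃ k : dualLattice Γ,
      lam = -(4 * (Real.pi : ℂ) ^ 2) * ((‖(k : EuclideanSpace ℝ (Fin n))‖ ^ 2 : ℝ) : ℂ) ∧
      ∃ c : ℂ, c ≠ 0 ∧ φ = c • torusExp k := by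
  have hu : ContDiff ℝ (⊤ : ℕ∞) (pull φ) := hF.1 φ hφ
  have hlam := (laplaceBeltrami_eq_iff (hF.1 φ hφ)).1 (hF.2.1 φ hφ)
  have hmu := conformality_eq_iff.1 (hF.2.2 φ hφ φ hφ)
  have hne' : ∃ x, pull φ x ≠ 0 := by
    obtain ⟨p, hp⟩ := Function.ne_iff.1 hne
    obtain ⟨x, rfl⟩ := proj_surjective p
    exact ⟨x, hp⟩
  obtain rfl := eigenvalues_eq hu hlam hmu hne'
  have hper : ∀ k ∈ Γ, ∀ x, pull φ (x + k) = pull φ x := fun k hk x => congrFun (pull_add φ hk) x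
  obtain ⟨k, hk, h0, hφk⟩ := eq_planeWave hu hper hlam hmu hne'
  have hmem : k ∈ dualLattice Γ := by
    refine mem_dualLattice.2 fun l hl => ?_
    -- Compare u(l) = u(0) with the plane-wave formula and cancel u(0) ≠ 0.
    have h1 : planeWave k l = 1 := by
      have h := hφk l
      rw [← zero_add l, hper l hl 0, zero_add] at h
      exact (mul_eq_left₀ h0).1 h.symm
    obtain ⟨m, hm⟩ := Complex.exp_eq_one_iff.1 h1
    refine ⟨m, ?_⟩
    have h2 : (2 * Real.pi * Complex.I) * ((inner ℝ k l : ℝ) : ℂ) = (2 * Real.pi * Complex.I) * m := by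
      rw [hm, mul_comm]
    exact_mod_cast mul_left_cancel₀ Complex.two_pi_I_ne_zero h2
  refine ⟨rfl, ⟨k, hmem⟩, hk, pull φ 0, h0, funext fun p => ?_⟩
  obtain ⟨x, rfl⟩ := proj_surjective p
  exact hφk x

/-- At the origin the κ-equation reads ⟨k, l⟩ = -mu/(4π²) = ‖k‖² = ‖l‖², hence ‖k - l‖² = 0. -/
lemma dual_eq_of_conformality {mu c d : ℂ} {k l : dualLattice Γ} (hc : c ≠ 0) (hd : d ≠ 0)
    (hk : mu = -(4 * (Real.pi : ℂ) ^ 2) * ((‖(k : EuclideanSpace ℝ (Fin n))‖ ^ 2 : ℝ) : ℂ))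
    (hl : mu = -(4 * (Real.pi : ℂ) ^ 2) * ((‖(l : EuclideanSpace ℝ (Fin n))‖ ^ 2 : ℝ) : ℂ))
    (h : conformality (c • torusExp k) (d • torusExp l) =
      mu • ((c • torusExp k) * (d • torusExp l))) : k = l := by
  have hpi : (4 * (Real.pi : ℂ) ^ 2) ≠ 0 := by simp [Real.pi_ne_zero]
  have h1 := conformality_eq_iff.1 h 0
  have hpull : ∀ (a : ℂ) (m : dualLattice Γ), pull (a • torusExp m) =
      fun x => a * planeWave (m : EuclideanSpace ℝ (Fin n)) x := fun a m => rfl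
  have hw : ∀ m : EuclideanSpace ℝ (Fin n), DifferentiableAt ℝ (planeWave m) 0 := fun m =>
    differentiableAt_of_smooth (contDiff_planeWave m).contDiffAt
  have h0 : ∀ m : EuclideanSpace ℝ (Fin n), planeWave m 0 = 1 := fun m => by simp [planeWave]
  simp only [hpull, pd_const_mul _ _ (hw _), pd_planeWave, h0, mul_one] at h1
  have h2 : mu = -(4 * (Real.pi : ℂ) ^ 2) *
      ((inner ℝ (k : EuclideanSpace ℝ (Fin n)) (l : EuclideanSpace ℝ (Fin n)) : ℝ) : ℂ) := by
    refine mul_right_cancel₀ (mul_ne_zero hc hd) (h1.symm.trans ?_)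
    rw [PiLp.inner_apply, Complex.ofReal_sum, Finset.mul_sum, Finset.sum_mul]
    refine Finset.sum_congr rfl fun i _ => ?_
    simp only [RCLike.inner_apply, conj_trivial]
    push_cast
    linear_combination (4 * (Real.pi : ℂ) ^ 2 * c * d * ((k : EuclideanSpace ℝ (Fin n)) i : ℂ) *
      ((l : EuclideanSpace ℝ (Fin n)) i : ℂ)) * Complex.I_sq
  have h3 := mul_left_cancel₀ (neg_ne_zero.2 hpi) (hk.symm.trans h2)
  have h4 := mul_left_cancel₀ (neg_ne_zero.2 hpi) (hl.symm.trans h2)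
  rw [Complex.ofReal_inj] at h3 h4
  apply Subtype.ext
  rw [← sub_eq_zero, ← norm_eq_zero, ← pow_eq_zero_iff two_ne_zero, norm_sub_sq_real]
  linarith

end Classification

end FlatTorusEigen

end

/-! ### The main theorem -/

theorem mainTheorem2 {n : ℕ} (Γ : Submodule ℤ (EuclideanSpace ℝ (Fin n)))
    [DiscreteTopology Γ] [IsZLattice ℝ Γ] (lam : ℂ) :
    (∀ f ∈ FlatTorusEigen.expSet Γ lam, FlatTorusEigen.IsEigenfunction lam lam f) ∧
    (∀ (mu : ℂ) (F : Set (FlatTorusEigen.FlatTorus Γ → ℂ)),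
      FlatTorusEigen.IsEigenfamily lam mu F → (∃ φ ∈ F, φ ≠ 0) →
        (∃ f ∈ FlatTorusEigen.expSet Γ lam, Submodule.span ℂ F = Submodule.span ℂ {f}) ∧
        lam = mu ∧ Module.finrank ℂ (Submodule.span ℂ F) = 1) := by
  refine ⟨fun f hf => FlatTorusEigen.isEigenfunction_of_mem_expSet hf, ?_⟩
  rintro mu F hF ⟨φ, hφ, hne⟩
  obtain ⟨rfl, k, hk, c, hc, hφk⟩ := FlatTorusEigen.exists_eq_smul_torusExp hF hφ hne
  have hpi : (Real.pi : ℂ) ≠ 0 := Complex.ofReal_ne_zero.2 Real.pi_ne_zero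
  have hspan : Submodule.span ℂ F = Submodule.span ℂ {FlatTorusEigen.torusExp k} := by
    apply le_antisymm
    · refine Submodule.span_le.2 fun ψ hψ => ?_
      -- The family may contain the zero function, which determines no wave vector.
      by_cases h0 : ψ = 0
      · rw [h0]
        exact Submodule.zero_mem _
      obtain ⟨-, l, hl, d, hd, hψl⟩ := FlatTorusEigen.exists_eq_smul_torusExp hF hψ h0
      have hconf := hF.2.2 φ hφ ψ hψ
      rw [hφk, hψl] at hconf
      obtain rfl := FlatTorusEigen.dual_eq_of_conformality hc hd hk hl hconf
      exact Submodule.mem_span_singleton.2 ⟨d, hψl.symm⟩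
    · rw [Submodule.span_singleton_le_iff_mem]
      have h := Submodule.smul_mem _ c⁻¹ (Submodule.subset_span (R := ℂ) hφ)
      rwa [hφk, inv_smul_smul₀ hc] at h
  refine ⟨⟨FlatTorusEigen.torusExp k, ⟨k, ?_, rfl⟩, hspan⟩, rfl, ?_⟩
  · rw [hk]
    field_simp
  · rw [hspan]
    refine finrank_span_singleton fun h0 => hne ?_
    rw [hφk, h0, smul_zero]
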